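/- Let $(S,\Sigma)$ be an arbitrary many-sorted signature and let ${\rm PROP}$, ${\rm NOM}$, ${\rm SVAR}$ be $S$-sorted sets of propositional variables, nominals and state variables (those of distinct sorts being disjoint) such that every sort has at least one state symbol, i.e. a nominal or a state variable. The formulas of ${\mathcal H}_\Sigma(@_z)$ of sort $s$ are $$\phi_s ::= p\mid j\mid x\mid \neg\phi_s\mid \phi_s\vee\phi_s\mid \sigma(\phi_{s_1},\ldots,\phi_{s_n})\mid @_z^s\psi_t,$$ where $p\in{\rm PROP}_s$, $j\in{\rm NOM}_s$, $x\in{\rm SVAR}_s$, $\sigma\in\Sigma_{s_1\cdots s_n,s}$ ($n\ge 0$), $z$ is a state symbol of sort $t$ and $\psi$ a formula of sort $t$; put $\sigma^{\Box}(\phi_1,\ldots,\phi_n):=\neg\sigma(\neg\phi_1,\ldots,\neg\phi_n)$. A model $\mathcal M=(W,(R_\sigma)_{\sigma\in\Sigma},V)$ consists of nonempty sets $W_s$ ($s\in S$), relations $R_\sigma\subseteq W_s\times W_{s_1}\times\cdots\times W_{s_n}$ for $\sigma\in\Sigma_{s_1\cdots s_n,s}$, and a valuation $V$ sending each $p\in{\rm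 PROP}_s$ to a subset of $W_s$ and each $j\in{\rm NOM}_s$ to a singleton of $W_s$; an assignment $g$ sends each $x\in{\rm SVAR}_s$ to an element of $W_s$. Write $Den_g(z)$ for the world denoted by the state symbol $z$. Satisfaction $\mathcal M,g,w\models\phi$ is defined as usual for propositional variables, $\neg$ and $\vee$; $\mathcal M,g,w\models z$ iff $w=Den_g(z)$; $\mathcal M,g,w\models\sigma(\phi_1,\ldots,\phi_n)$ iff there are $w_1,\ldots,w_n$ with $R_\sigma ww_1\ldots w_n$ and $\mathcal M,g,w_i\models\phi_i$ for all $i$; and $\mathcal M,g,w\models @_z^s\phi$ iff $\mathcal M,g,Den_g(z)\models\phi$. The axioms of ${\mathcal H}_\Sigma(@_z)$ are, on each sort, all propositional tautologies and all well-sorted instances of - $\sigma^{\Box}(\ldots,\phi\to\chi,\ldots)\to(\sigma^{\Box}(\ldots,\phi,\ldots)\to\sigma^{\Box}(\ldots,\chi,\ldots))$ and $\sigma(\psi_1,\ldots,\psi_n)\leftrightarrow\neg\sigma^{\Box}(\neg\psi_1,\ldots,\neg\psi_n)$; - $@_z^s(\phi\to\psi)\to(@_z^s\phi\to @_z^s\psi)$,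 $\;@_z^s\phi\leftrightarrow\neg @_z^s\neg\phi$, $\;z\to(\phi\leftrightarrow @_z^s\phi)$ (for $z,\phi$ of sort $s$), $\;@_y^t@_z^{t'}\phi\leftrightarrow @_z^t\phi$, $\;@_z^sz$, $\;\sigma(\ldots,@_z^{s_i}\psi,\ldots)\to @_z^s\psi$. Its rules are: modus ponens; from $\vdash\phi$ (of sort $s_i$) infer $\vdash\sigma^{\Box}(\phi_1,\ldots,\phi,\ldots,\phi_n)$ ($\phi$ in the $i$-th place); from $\vdash @_z^s\phi$ infer $\vdash @_z^{s'}\phi$; from $\vdash\phi$ infer $\vdash @_z^s\phi$ ($z,\phi$ of the same sort); from $\vdash @_z^s(y\wedge\phi)\to\psi$ infer $\vdash @_z^s\phi\to\psi$; from $\vdash @_z^s\sigma(\ldots,y\wedge\phi,\ldots)\to\psi$ infer $\vdash @_z^s\sigma(\ldots,\phi,\ldots)\to\psi$; in the last two rules $y$ is a state symbol distinct from $z$ that does not occur in $\phi$, in $\psi$, or in the other arguments of $\sigma$. For an $S$-sorted set $\Lambda$ of formulas (possibly empty), ${\mathcal H}_\Sigma(@_z)+\Lambda$ is the system with the members of $\Lambda$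 as additional axioms. A set $\Gamma$ of formulas of sort $s$ is consistent in it if there is no formula $\phi$ of sort $s$ such that both $\phi$ and $\neg\phi$ are derivable from $\Gamma$, where $\theta$ is derivable from $\Gamma$ if $\chi_1\to(\chi_2\to\cdots\to(\chi_n\to\theta))$ is a theorem of the system for some $n\ge 0$ and $\chi_1,\ldots,\chi_n\in\Gamma$. **Theorem (Completeness).** For every $S$-sorted set $\Lambda$ of formulas, every sort $s$ and every set $\Gamma$ of formulas of sort $s$ that is consistent in ${\mathcal H}_\Sigma(@_z)+\Lambda$, there are a model $\mathcal M$, an assignment $g$ and a world $w\in W_s$ such that $\mathcal M,g,w\models\phi$ for all $\phi\in\Gamma$, and moreover $\mathcal M,g,v\models\lambda$ for every sort $t$, every $\lambda\in\Lambda_t$ and every $v\in W_t$. In particular (with $\Lambda=\emptyset$), every consistent set of formulas of ${\mathcal H}_\Sigma(@_z)$ is satisfiable. -/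

import Mathlib

universe u

/-- The data of a many-sorted hybrid language: a many-sorted signature, where `Op n a s` is the set
of operation symbols `σ : a 0 ⋯ a (n-1) → s`, and the sorted sets of propositional variables,
nominals and state variables. Sets belonging to different sorts are automatically disjoint. -/
structure HybridSignature where
  Srt : Type u
  Op : (n : ℕ) → (Fin n → Srt) → Srt → Type u
  PROP : Srt → Type u
  NOM : Srt → Type u
  SVAR : Srt → Type u

namespace HybridSignature

/-- A state symbol of sort `t` is a nominal or a state variable of sort `t`. -/
inductive StSym (L : HybridSignature.{u}) (t : L.Srt) : Type u
  | nom (j : L.NOM t) : StSym L t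
  | svar (x : L.SVAR t) : StSym L t

/-- The formulas of sort `s`. The constructor `sym` covers the atoms `j` (nominals) and `x` (state
variables), and `sat s z φ` is `@_z^s φ`. -/
inductive Form (L : HybridSignature.{u}) : L.Srt → Type u
  | prop {s : L.Srt} (p : L.PROP s) : Form L s
  | sym {s : L.Srt} (z : L.StSym s) : Form L s
  | neg {s : L.Srt} (φ : Form L s) : Form L s
  | or {s : L.Srt} (φ ψ : Form L s) : Form L s
  | op {n : ℕ} {a : Fin n → L.Srt} {s : L.Srt} (σ : L.Op n a s) (φ : ∀ i, Form L (a i)) : Form L s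
  | sat (s : L.Srt) {t : L.Srt} (z : L.StSym t) (φ : Form L t) : Form L s

namespace Form

variable {L : HybridSignature.{u}}

def and {s : L.Srt} (φ ψ : L.Form s) : L.Form s := neg (or (neg φ) (neg ψ))

def imp {s : L.Srt} (φ ψ : L.Form s) : L.Form s := or (neg φ) ψ

def iff {s : L.Srt} (φ ψ : L.Form s) : L.Form s := and (imp φ ψ) (imp ψ φ)

/-- The dual operation `σ^□ (φ₁, …, φₙ) = ¬ σ (¬ φ₁, …, ¬ φₙ)`. -/
def box {n : ℕ} {a : Fin n → L.Srt} {s : L.Srt} (σ : L.Op n a s) (φ : ∀ i, L.Form (a i)) :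
    L.Form s :=
  neg (op σ fun i => neg (φ i))

/-- The state symbol `y` (given together with its sort) occurs in a formula, as an atom or as the
index of a satisfaction operator. -/
def Occurs (y : Σ t, L.StSym t) : ∀ {s : L.Srt}, L.Form s → Prop
  | _, prop _ => False
  | s, sym z => y = ⟨s, z⟩
  | _, neg φ => Occurs y φ
  | _, or φ ψ => Occurs y φ ∨ Occurs y ψ
  | _, op _ φ => ∃ i, Occurs y (φ i)
  | _, @sat _ _ t z φ => y = ⟨t, z⟩ ∨ Occurs y φ

/-- Theorems of propositional logic, where all formulas that are not negations or disjunctions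
count as atoms: true under every truth valuation that respects `¬` and `∨`. -/
def IsTautology {s : L.Srt} (φ : L.Form s) : Prop :=
  ∀ v : L.Form s → Prop, (∀ α, v (neg α) ↔ ¬ v α) → (∀ α β, v (or α β) ↔ (v α ∨ v β)) → v φ

end Form

open Form in
/-- `Thm Λ s φ`: the formula `φ` of sort `s` is a theorem of the system `H(@_z) + Λ`, that is, of
`H(@_z)` with the members of the sorted set `Λ` of formulas as additional axioms.
A list of arguments `…, φ_{i-1}, φ, φ_{i+1}, …` is written `Function.update χ i φ`. -/
inductive Thm {L : HybridSignature.{u}} (Λ : ∀ t : L.Srt, Set (L.Form t)) :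
    ∀ s : L.Srt, L.Form s → Prop
  | ax {s : L.Srt} {φ : L.Form s} (h : φ ∈ Λ s) : Thm Λ s φ
  | taut {s : L.Srt} {φ : L.Form s} (h : φ.IsTautology) : Thm Λ s φ
  | axK {n : ℕ} {a : Fin n → L.Srt} {s : L.Srt} (σ : L.Op n a s) (χ : ∀ i, L.Form (a i))
      (i : Fin n) (φ ψ : L.Form (a i)) :
      Thm Λ s (imp (box σ (Function.update χ i (imp φ ψ)))
        (imp (box σ (Function.update χ i φ)) (box σ (Function.update χ i ψ))))
  | axDual {n : ℕ} {a : Fin n → L.Srt} {s : L.Srt} (σ : L.Op n a s) (χ : ∀ i, L.Form (a i)) :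
      Thm Λ s (iff (op σ χ) (neg (box σ fun i => neg (χ i))))
  | axKAt (s : L.Srt) {t : L.Srt} (z : L.StSym t) (φ ψ : L.Form t) :
      Thm Λ s (imp (sat s z (imp φ ψ)) (imp (sat s z φ) (sat s z ψ)))
  | axSelfDual (s : L.Srt) {t : L.Srt} (z : L.StSym t) (φ : L.Form t) :
      Thm Λ s (iff (sat s z φ) (neg (sat s z (neg φ))))
  | axIntro {s : L.Srt} (z : L.StSym s) (φ : L.Form s) :
      Thm Λ s (imp (sym z) (iff φ (sat s z φ)))
  | axAgree {s t t' : L.Srt} (y : L.StSym t') (z : L.StSym s) (φ : L.Form s) :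
      Thm Λ t (iff (sat t y (sat t' z φ)) (sat t z φ))
  | axRef (s : L.Srt) {t : L.Srt} (z : L.StSym t) : Thm Λ s (sat s z (sym z))
  | axBack {n : ℕ} {a : Fin n → L.Srt} {s t : L.Srt} (σ : L.Op n a s) (χ : ∀ i, L.Form (a i))
      (i : Fin n) (z : L.StSym t) (ψ : L.Form t) :
      Thm Λ s (imp (op σ (Function.update χ i (sat (a i) z ψ))) (sat s z ψ))
  | mp {s : L.Srt} {φ ψ : L.Form s} (h : Thm Λ s φ) (h' : Thm Λ s (imp φ ψ)) : Thm Λ s ψ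
  | ug {n : ℕ} {a : Fin n → L.Srt} {s : L.Srt} (σ : L.Op n a s) (χ : ∀ i, L.Form (a i))
      (i : Fin n) {φ : L.Form (a i)} (h : Thm Λ (a i) φ) :
      Thm Λ s (box σ (Function.update χ i φ))
  | broadcast {s t : L.Srt} (s' : L.Srt) {z : L.StSym t} {φ : L.Form t}
      (h : Thm Λ s (sat s z φ)) : Thm Λ s' (sat s' z φ)
  | genAt (s : L.Srt) {t : L.Srt} (z : L.StSym t) {φ : L.Form t} (h : Thm Λ t φ) :
      Thm Λ s (sat s z φ)
  | paste0 {s t : L.Srt} (z y : L.StSym t) (φ : L.Form t) (ψ : L.Form s)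
      (hz : y ≠ z) (hφ : ¬ φ.Occurs ⟨t, y⟩) (hψ : ¬ ψ.Occurs ⟨t, y⟩)
      (h : Thm Λ s (imp (sat s z (and (sym y) φ)) ψ)) :
      Thm Λ s (imp (sat s z φ) ψ)
  | paste1 {n : ℕ} {a : Fin n → L.Srt} {s t : L.Srt} (σ : L.Op n a t) (χ : ∀ i, L.Form (a i))
      (i : Fin n) (z : L.StSym t) (y : L.StSym (a i)) (φ : L.Form (a i)) (ψ : L.Form s)
      (hz : (⟨a i, y⟩ : Σ t, L.StSym t) ≠ ⟨t, z⟩)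
      (hχ : ∀ k, k ≠ i → ¬ (χ k).Occurs ⟨a i, y⟩)
      (hφ : ¬ φ.Occurs ⟨a i, y⟩) (hψ : ¬ ψ.Occurs ⟨a i, y⟩)
      (h : Thm Λ s (imp (sat s z (op σ (Function.update χ i (and (sym y) φ)))) ψ)) :
      Thm Λ s (imp (sat s z (op σ (Function.update χ i φ))) ψ)

/-- Derivability from a set of formulas of sort `s` (local consequence):
`⊢ χ₁ → (χ₂ → ⋯ → (χₙ → φ))` for some `χ₁, …, χₙ ∈ Γ`, `n ≥ 0`. -/
def Derives {L : HybridSignature.{u}} (Λ : ∀ t : L.Srt, Set (L.Form t)) {s : L.Srt}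
    (Γ : Set (L.Form s)) (φ : L.Form s) : Prop :=
  ∃ l : List (L.Form s), (∀ χ ∈ l, χ ∈ Γ) ∧ Thm Λ s (l.foldr Form.imp φ)

/-- `Γ` is consistent in `H(@_z) + Λ`: no contradiction is derivable from it. -/
def Consistent {L : HybridSignature.{u}} (Λ : ∀ t : L.Srt, Set (L.Form t)) {s : L.Srt}
    (Γ : Set (L.Form s)) : Prop :=
  ¬ ∃ φ : L.Form s, Derives Λ Γ φ ∧ Derives Λ Γ (Form.neg φ)

/-- Models: nonempty sets of worlds for every sort, a relation for every operation symbol, and a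
valuation. The value of a nominal is a singleton, given here by its only element. -/
structure Model (L : HybridSignature.{u}) where
  W : L.Srt → Type u
  nonempty : ∀ s, Nonempty (W s)
  R : ∀ {n : ℕ} {a : Fin n → L.Srt} {s : L.Srt}, L.Op n a s → W s → (∀ i, W (a i)) → Prop
  V : ∀ {s : L.Srt}, L.PROP s → Set (W s)
  N : ∀ {s : L.Srt}, L.NOM s → W s

namespace Model

variable {L : HybridSignature.{u}} (M : L.Model)

/-- Assignments of worlds to state variables. -/
abbrev Assignment : Type u := ∀ s : L.Srt, L.SVAR s → M.W s

/-- The denotation of a state symbol. -/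
def den (g : M.Assignment) {s : L.Srt} : L.StSym s → M.W s
  | .nom j => M.N j
  | .svar x => g s x

/-- `M.Sat g φ w`: the formula `φ` is satisfied at the world `w` under the assignment `g`. -/
def Sat (g : M.Assignment) : ∀ {s : L.Srt}, L.Form s → M.W s → Prop
  | _, .prop p, w => w ∈ M.V p
  | _, .sym z, w => w = M.den g z
  | _, .neg φ, w => ¬ Sat g φ w
  | _, .or φ ψ, w => Sat g φ w ∨ Sat g ψ w
  | _, .op (a := a) σ φ, w => ∃ v : ∀ i, M.W (a i), M.R σ w v ∧ ∀ i, Sat g (φ i) (v i)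
  | _, .sat _ z φ, _ => Sat g φ (M.den g z)

end Model

end HybridSignature

/-! Extend `Γ` to a maximal consistent set `T`, and take as worlds of sort `t` all maximal
consistent sets of sort `t` with the same satisfaction statements as `T`. Worlds need not be named,
so neither fresh state symbols nor the paste rules are needed. For each `z` the set `named T z` is a
world, and by `axIntro` it is the only one containing `z`; hence state symbols denote correctly. The
crux is the existence lemma `exists_successors`: the successors of a world must be found for all
arguments of `σ` at once. `axBack` shows that they agree with `T`. The truth lemma follows by
induction, and every world satisfies `Λ` because it contains all theorems. -/

namespace HybridSignature

open Form

variable {L : HybridSignature.{u}} {Λ : ∀ t : L.Srt, Set (L.Form t)}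

/-! ### Propositional and modal derivations -/

namespace Form

variable {s : L.Srt} {v : L.Form s → Prop}

theorem val_imp (hn : ∀ α, v (neg α) ↔ ¬ v α) (ho : ∀ α β, v (or α β) ↔ (v α ∨ v β))
    (α β : L.Form s) : v (imp α β) ↔ (v α → v β) := by
  simp only [imp, hn, ho]; tauto

theorem val_and (hn : ∀ α, v (neg α) ↔ ¬ v α) (ho : ∀ α β, v (or α β) ↔ (v α ∨ v β))
    (α β : L.Form s) : v (and α β) ↔ (v α ∧ v β) := by
  simp only [and, hn, ho]; tauto

theorem val_iff (hn : ∀ α, v (neg α) ↔ ¬ v α) (ho : ∀ α β, v (or α β) ↔ (v α ∨ v β))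
    (α β : L.Form s) : v (iff α β) ↔ (v α ↔ v β) := by
  simp only [iff, val_and hn ho, val_imp hn ho]; tauto

theorem update_neg {n : ℕ} {a : Fin n → L.Srt} (χ : ∀ i, L.Form (a i)) (i : Fin n)
    (φ : L.Form (a i)) :
    Function.update (fun k => neg (χ k)) i (neg φ) = fun k => neg (Function.update χ i φ k) := by
  funext k
  rw [Function.apply_update (fun _ => neg)]

end Form

namespace Thm

variable {s : L.Srt} {α β γ δ : L.Form s}

/-- A tautological consequence of a theorem is a theorem. -/
theorem taut₁ (h₁ : Thm Λ s α)
    (h : ∀ v : L.Form s → Prop, (∀ α, v (neg α) ↔ ¬ v α) →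
      (∀ α β, v (or α β) ↔ (v α ∨ v β)) → v α → v β) : Thm Λ s β :=
  h₁.mp (taut fun v hn ho => (val_imp hn ho _ _).2 (h v hn ho))

/-- A tautological consequence of two theorems is a theorem. -/
theorem taut₂ (h₁ : Thm Λ s α) (h₂ : Thm Λ s β)
    (h : ∀ v : L.Form s → Prop, (∀ α, v (neg α) ↔ ¬ v α) →
      (∀ α β, v (or α β) ↔ (v α ∨ v β)) → v α → v β → v γ) : Thm Λ s γ :=
  h₂.mp (h₁.taut₁ fun v hn ho hv => (val_imp hn ho _ _).2 (h v hn ho hv))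

/-- A tautological consequence of three theorems is a theorem. -/
theorem taut₃ (h₁ : Thm Λ s α) (h₂ : Thm Λ s β) (h₃ : Thm Λ s γ)
    (h : ∀ v : L.Form s → Prop, (∀ α, v (neg α) ↔ ¬ v α) →
      (∀ α β, v (or α β) ↔ (v α ∨ v β)) → v α → v β → v γ → v δ) : Thm Λ s δ :=
  h₃.mp (h₁.taut₂ h₂ fun v hn ho hv hv' => (val_imp hn ho _ _).2 (h v hn ho hv hv'))

theorem imp_trans (h₁ : Thm Λ s (imp α β)) (h₂ : Thm Λ s (imp β γ)) : Thm Λ s (imp α γ) :=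
  h₁.taut₂ h₂ fun v hn ho => by simp only [val_imp hn ho]; tauto

section Op

variable {n : ℕ} {a : Fin n → L.Srt} (σ : L.Op n a s)

theorem not_op_update (χ : ∀ i, L.Form (a i)) (i : Fin n) {φ : L.Form (a i)}
    (h : Thm Λ (a i) (neg φ)) : Thm Λ s (neg (op σ (Function.update χ i φ))) := by
  have h₁ := ug σ (fun k => neg (χ k)) i h
  rw [update_neg] at h₁
  exact h₁.taut₂ (axDual σ (Function.update χ i φ)) fun v hn ho => by
    simp only [val_iff hn ho, hn]; tauto

/-- Contraposed, this is `axK` used twice on negated arguments. It allows one argument to be decided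
at a time in the existence lemma. -/
theorem op_update_split (χ : ∀ i, L.Form (a i)) (i : Fin n) {φ ψ θ : L.Form (a i)}
    (h : Thm Λ (a i) (imp φ (or ψ θ))) :
    Thm Λ s (imp (op σ (Function.update χ i φ))
      (or (op σ (Function.update χ i ψ)) (op σ (Function.update χ i θ)))) := by
  have h' : Thm Λ (a i) (imp (neg ψ) (imp (neg θ) (neg φ))) :=
    h.taut₁ fun v hn ho => by simp only [val_imp hn ho, hn, ho]; tauto
  have h₁ := (ug σ (fun k => neg (χ k)) i h').mp (axK σ (fun k => neg (χ k)) i _ _)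
  have h₂ := h₁.imp_trans (axK σ (fun k => neg (χ k)) i _ _)
  simp only [update_neg] at h₂
  have d (η : L.Form (a i)) := axDual (Λ := Λ) σ (Function.update χ i η)
  refine h₂.mp ((d φ).taut₃ (d ψ) (d θ) fun v hn ho => ?_)
  simp only [val_imp hn ho, val_iff hn ho, hn, ho]
  tauto

theorem op_update_mono (χ : ∀ i, L.Form (a i)) (i : Fin n) {φ ψ : L.Form (a i)}
    (h : Thm Λ (a i) (imp φ ψ)) :
    Thm Λ s (imp (op σ (Function.update χ i φ)) (op σ (Function.update χ i ψ))) := by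
  have h' : Thm Λ (a i) (imp φ (or ψ ψ)) :=
    h.taut₁ fun v hn ho => by simp only [val_imp hn ho, ho]; tauto
  exact (op_update_split σ χ i h').taut₁ fun v hn ho => by simp only [val_imp hn ho, ho]; tauto

theorem op_mono {φ ψ : ∀ i, L.Form (a i)} (h : ∀ i, Thm Λ (a i) (imp (φ i) (ψ i))) :
    Thm Λ s (imp (op σ φ) (op σ ψ)) := by
  have key (A : Finset (Fin n)) : Thm Λ s (imp (op σ φ) (op σ (A.piecewise ψ φ))) := by
    -- The arguments in `A` have already been replaced; each step replaces one more.
    induction A using Finset.induction_on with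
    | empty =>
      rw [Finset.piecewise_empty]
      exact taut fun v hn ho => (val_imp hn ho _ _).2 id
    | insert i A hi ih =>
      rw [Finset.piecewise_insert]
      have := op_update_mono σ (A.piecewise ψ φ) i (h i)
      -- Argument `i` is still `φ i`, so updating it by `φ i` changes nothing.
      rw [Function.update_eq_self_iff.2 (Finset.piecewise_eq_of_notMem _ _ _ hi).symm] at this
      exact ih.imp_trans this
  simpa using key Finset.univ

end Op

end Thm

/-! ### Maximal consistent sets and their existence -/

/-- Maximal consistent sets of formulas of a given sort. -/
structure IsMaximalConsistent (Λ : ∀ t : L.Srt, Set (L.Form t)) {s : L.Srt}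
    (T : Set (L.Form s)) : Prop where
  thm_mem : ∀ {φ}, Thm Λ s φ → φ ∈ T
  mp_mem : ∀ {φ ψ}, φ ∈ T → imp φ ψ ∈ T → ψ ∈ T
  neg_mem : ∀ {φ}, neg φ ∈ T ↔ φ ∉ T

namespace IsMaximalConsistent

variable {s : L.Srt} {T : Set (L.Form s)} {φ ψ : L.Form s}

theorem mem_of_imp (hT : IsMaximalConsistent Λ T) (h : Thm Λ s (imp φ ψ)) (hφ : φ ∈ T) : ψ ∈ T :=
  hT.mp_mem hφ (hT.thm_mem h)

theorem or_mem (hT : IsMaximalConsistent Λ T) : or φ ψ ∈ T ↔ φ ∈ T ∨ ψ ∈ T := by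
  constructor
  · intro h
    by_contra! hc
    refine hT.neg_mem.1 (hT.mp_mem (hT.neg_mem.2 hc.2) (hT.mp_mem (hT.neg_mem.2 hc.1)
      (hT.thm_mem (.taut fun v hn ho => ?_)))) h
    simp only [val_imp hn ho, hn, ho]; tauto
  · rintro (h | h) <;> refine hT.mem_of_imp (.taut fun v hn ho => ?_) h <;>
      simp only [val_imp hn ho, ho] <;> tauto

theorem iff_mem (hT : IsMaximalConsistent Λ T) : iff φ ψ ∈ T ↔ (φ ∈ T ↔ ψ ∈ T) :=
  val_iff (fun _ => hT.neg_mem) (fun _ _ => hT.or_mem) φ ψ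

theorem mem_iff_of_iff (hT : IsMaximalConsistent Λ T) (h : Thm Λ s (iff φ ψ)) : φ ∈ T ↔ ψ ∈ T :=
  hT.iff_mem.1 (hT.thm_mem h)

theorem sat_neg_mem (hT : IsMaximalConsistent Λ T) {t : L.Srt} {z : L.StSym t} {θ : L.Form t} :
    sat s z (neg θ) ∈ T ↔ sat s z θ ∉ T := by
  have := hT.mem_iff_of_iff (.axSelfDual s z θ)
  rw [hT.neg_mem] at this
  tauto

end IsMaximalConsistent

/-- Simultaneous extension to maximal consistent sets. A property `G` of families of formulas is
given that is preserved by adding `ψ` or `¬ ψ` to one of the components, and that excludes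
refutable components. If all finite parts of `S₀` are implied by a family with the property, then
`S₀` extends to a family of maximal consistent sets of the same kind. -/
theorem exists_isMaximalConsistent_family {ι : Type*} [DecidableEq ι] {a : ι → L.Srt}
    (G : (∀ i, L.Form (a i)) → Prop)
    (hsplit : ∀ τ i ψ, G τ → G (Function.update τ i (and (τ i) ψ)) ∨
      G (Function.update τ i (and (τ i) (neg ψ))))
    (hcons : ∀ τ i, G τ → ¬ Thm Λ (a i) (neg (τ i)))
    (S₀ : Set (Σ i, L.Form (a i)))
    (h₀ : ∀ F : Set (Σ i, L.Form (a i)), F.Finite → F ⊆ S₀ →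
      ∃ τ, G τ ∧ ∀ p ∈ F, Thm Λ _ (imp (τ p.1) p.2)) :
    ∃ A : ∀ i, Set (L.Form (a i)), (∀ i, IsMaximalConsistent Λ (A i)) ∧
      (∀ p ∈ S₀, p.2 ∈ A p.1) ∧
      ∀ F : Set (Σ i, L.Form (a i)), F.Finite → (∀ p ∈ F, p.2 ∈ A p.1) →
        ∃ τ, G τ ∧ ∀ p ∈ F, Thm Λ _ (imp (τ p.1) p.2) := by
  let P (S : Set (Σ i, L.Form (a i))) : Prop :=
    ∀ F : Set (Σ i, L.Form (a i)), F.Finite → F ⊆ S →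
      ∃ τ, G τ ∧ ∀ p ∈ F, Thm Λ _ (imp (τ p.1) p.2)
  obtain ⟨S, hS₀, hS⟩ := zorn_subset_nonempty {S | P S} (by
    intro c hc hchain hne
    refine ⟨⋃₀ c, fun F hF hFc => ?_, fun _ => Set.subset_sUnion_of_mem⟩
    obtain ⟨S, hSc, hFS⟩ := hchain.directedOn.exists_mem_subset_of_finite_of_subset_sUnion
      hne hF hFc
    exact hc hSc F hF hFS) S₀ h₀
  have hPS : P S := hS.prop
  -- By maximality, a pair outside `S` is blocked by a finite part of `S`.
  have ext {p} (hp : p ∉ S) : ∃ F : Set (Σ i, L.Form (a i)), F.Finite ∧ F ⊆ S ∧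
      ∀ τ, G τ → (∀ q ∈ F, Thm Λ _ (imp (τ q.1) q.2)) → ¬ Thm Λ _ (imp (τ p.1) p.2) := by
    by_contra! hc
    refine hp (hS.le_of_ge (y := insert p S) (fun F hF hFS => ?_) (Set.subset_insert p S)
      (Set.mem_insert p S))
    obtain ⟨τ, hτ, h₁, h₂⟩ := hc (F \ {p}) hF.sdiff (by
      rintro q ⟨hq, hqp⟩
      exact (hFS hq).resolve_left hqp)
    refine ⟨τ, hτ, fun q hq => ?_⟩
    by_cases h : q = p
    · exact h ▸ h₂
    · exact h₁ q ⟨hq, h⟩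
  have total (i) (ψ : L.Form (a i)) : ⟨i, ψ⟩ ∈ S ∨ ⟨i, neg ψ⟩ ∈ S := by
    by_contra! hc
    obtain ⟨F₁, hF₁, hFS₁, h₁⟩ := ext hc.1
    obtain ⟨F₂, hF₂, hFS₂, h₂⟩ := ext hc.2
    -- One family implies both obstructions; strengthening its component `i` by `ψ` or `¬ ψ` keeps
    -- `G` and defeats one of them.
    obtain ⟨τ, hτ, hτF⟩ := hPS (F₁ ∪ F₂) (hF₁.union hF₂) (Set.union_subset hFS₁ hFS₂)
    have weaken (θ : L.Form (a i)) (q : Σ i, L.Form (a i)) (hq : q ∈ F₁ ∪ F₂) :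
        Thm Λ _ (imp (Function.update τ i (and (τ i) θ) q.1) q.2) := by
      obtain ⟨k, η⟩ := q
      by_cases h : k = i
      · subst h
        simp only [Function.update_self]
        exact (hτF _ hq).taut₁ fun v hn ho => by
          simp only [val_imp hn ho, val_and hn ho]; tauto
      · simpa only [Function.update_of_ne h] using hτF _ hq
    have right (θ : L.Form (a i)) :
        Thm Λ _ (imp (Function.update τ i (and (τ i) θ) i) θ) := by
      rw [Function.update_self]
      exact .taut fun v hn ho => by simp only [val_imp hn ho, val_and hn ho]; tauto
    rcases hsplit τ i ψ hτ with h | h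
    · exact h₁ _ h (fun q hq => weaken ψ q (.inl hq)) (right ψ)
    · exact h₂ _ h (fun q hq => weaken (neg ψ) q (.inr hq)) (right (neg ψ))
  -- Three possibly equal premises cover all the closure properties below.
  have cons {i} {φ ψ θ : L.Form (a i)} (h : Thm Λ _ (imp φ (imp ψ (neg θ))))
      (hφ : ⟨i, φ⟩ ∈ S) (hψ : ⟨i, ψ⟩ ∈ S) (hθ : ⟨i, θ⟩ ∈ S) : False := by
    obtain ⟨τ, hτ, hτF⟩ := hPS {⟨i, φ⟩, ⟨i, ψ⟩, ⟨i, θ⟩} (by simp) (by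
      rintro q (rfl | rfl | rfl) <;> assumption)
    have h₁ := hτF ⟨i, φ⟩ (by simp)
    have h₂ := hτF ⟨i, ψ⟩ (by simp)
    have h₃ := hτF ⟨i, θ⟩ (by simp)
    refine hcons τ i hτ (h.mp (h₁.taut₃ h₂ h₃ fun v hn ho => ?_))
    simp only [val_imp hn ho, hn]; tauto
  refine ⟨fun i => {ψ | (⟨i, ψ⟩ : Σ i, L.Form (a i)) ∈ S}, fun i => ⟨?_, ?_, ?_⟩, fun p hp => hS₀ hp,
    fun F hF hFS => hPS F hF hFS⟩
  · intro φ h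
    refine (total i φ).resolve_right fun hn => cons (h.taut₁ fun v hn ho => ?_) hn hn hn
    simp only [val_imp hn ho, hn]; tauto
  · intro φ ψ hφ hφψ
    refine (total i ψ).resolve_right fun hn => cons (.taut fun v hn ho => ?_) hφ hφψ hn
    simp only [val_imp hn ho, hn]; tauto
  · intro φ
    refine ⟨fun hn hφ => cons (.taut fun v hn ho => ?_) hn hn hφ, (total i φ).resolve_left⟩
    simp only [val_imp hn ho, hn]; tauto

/-- A formula equivalent to the conjunction of a list of formulas. -/
theorem exists_conj {s : L.Srt} (θ : L.Form s) (l : List (L.Form s)) :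
    ∃ κ : L.Form s, (∀ χ ∈ l, Thm Λ s (imp κ χ)) ∧
      (Thm Λ s (neg κ) → ∀ η, Thm Λ s (l.foldr imp η)) := by
  suffices ∃ κ : L.Form s, ∀ v : L.Form s → Prop, (∀ α, v (neg α) ↔ ¬ v α) →
      (∀ α β, v (or α β) ↔ (v α ∨ v β)) → (∀ χ ∈ l, v κ → v χ) ∧
        (¬ v κ → ∀ η, v (l.foldr imp η)) by
    obtain ⟨κ, hκ⟩ := this
    exact ⟨κ, fun χ hχ => .taut fun v hn ho => (val_imp hn ho _ _).2 ((hκ v hn ho).1 χ hχ),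
      fun h η => h.taut₁ fun v hn ho hv => (hκ v hn ho).2 ((hn _).1 hv) η⟩
  induction l with
  -- There is no constant for truth; `θ` supplies a tautology as the empty conjunction.
  | nil => exact ⟨imp θ θ, fun v hn ho => by simp [val_imp hn ho]⟩
  | cons χ l ih =>
    obtain ⟨κ, hκ⟩ := ih
    refine ⟨and χ κ, fun v hn ho => ?_⟩
    have := hκ v hn ho
    simp only [List.mem_cons, forall_eq_or_imp, List.foldr_cons, val_and hn ho, val_imp hn ho]
    exact ⟨⟨And.left, fun η hη h => this.1 η hη h.2⟩,
      fun h η hχ => this.2 (fun hκ => h ⟨hχ, hκ⟩) η⟩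

/-- Lindenbaum's lemma. -/
theorem Consistent.exists_isMaximalConsistent {s : L.Srt} (θ : L.Form s) {Γ : Set (L.Form s)}
    (hΓ : Consistent Λ Γ) : ∃ T, Γ ⊆ T ∧ IsMaximalConsistent Λ T := by
  obtain ⟨A, hA, hΓA, -⟩ := exists_isMaximalConsistent_family (Λ := Λ) (a := fun _ : Unit => s)
    (fun τ => ¬ Thm Λ s (neg (τ ()))) (fun τ _ ψ hτ => by
      by_contra! hc
      simp only [Function.update_self] at hc
      exact hτ (hc.1.taut₂ hc.2 fun v hn ho => by simp only [hn, val_and hn ho]; tauto))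
    (fun _ _ => id) {p | p.2 ∈ Γ} (fun F hF hFΓ => by
      obtain ⟨κ, hκ, hκF⟩ := exists_conj (Λ := Λ) θ (hF.toFinset.toList.map Sigma.snd)
      refine ⟨fun _ => κ, fun h => hΓ ⟨θ, ⟨_, ?_, hκF h θ⟩, ⟨_, ?_, hκF h (neg θ)⟩⟩,
        fun p hp => hκ _ (List.mem_map_of_mem (by simpa using hp))⟩
      all_goals
        simp only [List.mem_map, Finset.mem_toList, Set.Finite.mem_toFinset]
        rintro χ ⟨p, hp, rfl⟩
        exact hFΓ hp)
  exact ⟨A (), fun φ hφ => hΓA ⟨(), φ⟩ hφ, hA ()⟩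

/-- The existence lemma: a maximal consistent set containing `σ (φ₁, …, φₙ)` has canonical
successors containing `φ₁, …, φₙ`. -/
theorem IsMaximalConsistent.exists_successors {n : ℕ} {a : Fin n → L.Srt} {s : L.Srt}
    {T : Set (L.Form s)} (hT : IsMaximalConsistent Λ T) (σ : L.Op n a s) {φ : ∀ i, L.Form (a i)}
    (h : op σ φ ∈ T) :
    ∃ A : ∀ i, Set (L.Form (a i)), (∀ i, IsMaximalConsistent Λ (A i)) ∧ (∀ i, φ i ∈ A i) ∧
      ∀ ψ : ∀ i, L.Form (a i), (∀ i, ψ i ∈ A i) → op σ ψ ∈ T := by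
  obtain ⟨A, hA, hφ, hF⟩ := exists_isMaximalConsistent_family (Λ := Λ)
    (fun τ => op σ τ ∈ T) (fun τ i ψ hτ => by
      rw [← hT.or_mem]
      refine hT.mem_of_imp (.op_update_split σ τ i (φ := τ i) (.taut fun v hn ho => ?_))
        (by rwa [Function.update_eq_self])
      simp only [val_imp hn ho, val_and hn ho, hn, ho]; tauto)
    (fun τ i hτ hneg => by
      have := hT.thm_mem (hneg.not_op_update σ τ i)
      rw [Function.update_eq_self, hT.neg_mem] at this
      exact this hτ)
    (Set.range fun i => ⟨i, φ i⟩) (fun F _ hF => ⟨φ, h, fun p hp => by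
      obtain ⟨i, rfl⟩ := hF hp
      exact .taut fun v hn ho => (val_imp hn ho _ _).2 id⟩)
  refine ⟨A, hA, fun i => hφ ⟨i, φ i⟩ ⟨i, rfl⟩, fun ψ hψ => ?_⟩
  -- Since `σ` has finitely many arguments, the `ψ i` form a finite part, implied by some `τ` with
  -- `σ τ ∈ T`; monotonicity of `σ` finishes.
  obtain ⟨τ, hτ, hτψ⟩ := hF (Set.range fun i => ⟨i, ψ i⟩) (Set.finite_range _) (by
    rintro p ⟨i, rfl⟩
    exact hψ i)
  exact hT.mem_of_imp (.op_mono σ fun i => hτψ ⟨i, ψ i⟩ ⟨i, rfl⟩) hτ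

/-! ### Worlds and the canonical model -/

/-- The formulas that hold at the world named `z` according to `T`. -/
def named {s t : L.Srt} (T : Set (L.Form s)) (z : L.StSym t) : Set (L.Form t) :=
  {φ | sat s z φ ∈ T}

/-- The worlds of sort `t` of the canonical model for `T`: the maximal consistent sets that contain
the same satisfaction statements as `T`. -/
def IsWorld (Λ : ∀ t : L.Srt, Set (L.Form t)) {s : L.Srt} (T : Set (L.Form s)) {t : L.Srt}
    (U : Set (L.Form t)) : Prop :=
  IsMaximalConsistent Λ U ∧
    ∀ {r : L.Srt} (z : L.StSym r) (ψ : L.Form r), sat t z ψ ∈ U ↔ sat s z ψ ∈ T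

namespace IsMaximalConsistent

variable {s : L.Srt} {T : Set (L.Form s)}

theorem isWorld_self (hT : IsMaximalConsistent Λ T) : IsWorld Λ T T := ⟨hT, fun _ _ => Iff.rfl⟩

theorem isWorld_named (hT : IsMaximalConsistent Λ T) {t : L.Srt} (z : L.StSym t) :
    IsWorld Λ T (named T z) where
  left :=
    { thm_mem := fun h => hT.thm_mem (.genAt s z h)
      mp_mem := fun {φ ψ} hφ hφψ => hT.mp_mem hφ (hT.mem_of_imp (.axKAt s z φ ψ) hφψ)
      neg_mem := hT.sat_neg_mem }
  right y ψ := hT.mem_iff_of_iff (.axAgree z y ψ)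

/-- Once `z` is in `U`, `axIntro` equates `φ` with `@_z φ` in `U`, and satisfaction statements are
shared with `T`. -/
theorem eq_named_iff (hT : IsMaximalConsistent Λ T) {t : L.Srt} {U : Set (L.Form t)}
    (hU : IsWorld Λ T U) (z : L.StSym t) :
    U = named T z ↔ sym z ∈ U := by
  constructor
  · rintro rfl
    exact hT.thm_mem (.axRef s z)
  · intro hz
    ext φ
    exact (hU.1.iff_mem.1 (hU.1.mem_of_imp (.axIntro z φ) hz)).trans (hU.2 z φ)

theorem exists_world_successors (hT : IsMaximalConsistent Λ T) {t : L.Srt} {U : Set (L.Form t)}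
    (hU : IsWorld Λ T U) {n : ℕ} {a : Fin n → L.Srt} (σ : L.Op n a t) {φ : ∀ i, L.Form (a i)} (h : op σ φ ∈ U) :
    ∃ A : ∀ i, Set (L.Form (a i)), (∀ i, IsWorld Λ T (A i)) ∧ (∀ i, φ i ∈ A i) ∧
      ∀ ψ : ∀ i, L.Form (a i), (∀ i, ψ i ∈ A i) → op σ ψ ∈ U := by
  obtain ⟨A, hA, hφ, hR⟩ := hU.1.exists_successors σ h
  have back (i) {r : L.Srt} (z : L.StSym r) (ψ : L.Form r) (hψ : sat (a i) z ψ ∈ A i) :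
      sat s z ψ ∈ T := by
    -- Put `@_z ψ` in place `i` and keep `φ` elsewhere; `axBack` then moves it to `U`.
    refine (hU.2 z ψ).1 (hU.1.mem_of_imp (.axBack σ φ i z ψ) (hR _ fun k => ?_))
    by_cases hk : k = i
    · subst hk
      rwa [Function.update_self]
    · rw [Function.update_of_ne hk]
      exact hφ k
  refine ⟨A, fun i => ⟨hA i, fun z ψ => ⟨back i z ψ, fun hψ => ?_⟩⟩, hφ, hR⟩
  by_contra hn
  -- Self-duality of `@_z` gives the converse: apply `back` to the negation.
  exact hT.sat_neg_mem.1 (back i z _ ((hA i).sat_neg_mem.2 hn)) hψ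

end IsMaximalConsistent

/-- The canonical model for a maximal consistent set `T`. -/
def canonicalModel (hL : ∀ t : L.Srt, Nonempty (L.StSym t)) {s : L.Srt} {T : Set (L.Form s)}
    (hT : IsMaximalConsistent Λ T) : L.Model where
  W t := {U : Set (L.Form t) // IsWorld Λ T U}
  nonempty t := (hL t).map fun z => ⟨named T z, hT.isWorld_named z⟩
  R σ w v := ∀ ψ, (∀ i, ψ i ∈ (v i).1) → op σ ψ ∈ w.1
  V p := {w | prop p ∈ w.1}
  N j := ⟨named T (.nom j), hT.isWorld_named _⟩

section Canonical

variable (hL : ∀ t : L.Srt, Nonempty (L.StSym t)) {s : L.Srt} {T : Set (L.Form s)}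
  (hT : IsMaximalConsistent Λ T)

/-- The canonical assignment. -/
def canonicalAssignment : (canonicalModel hL hT).Assignment :=
  fun _ x => ⟨named T (.svar x), hT.isWorld_named _⟩

theorem den_canonicalModel {t : L.Srt} (z : L.StSym t) :
    (canonicalModel hL hT).den (canonicalAssignment hL hT) z =
      (⟨named T z, hT.isWorld_named z⟩ : {U : Set (L.Form t) // IsWorld Λ T U}) := by
  cases z <;> rfl

/-- The truth lemma. -/
theorem sat_canonicalModel {t : L.Srt} (φ : L.Form t)
    (w : {U : Set (L.Form t) // IsWorld Λ T U}) :
    (canonicalModel hL hT).Sat (canonicalAssignment hL hT) φ w ↔ φ ∈ w.1 := by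
  induction φ with
  | prop p => exact Iff.rfl
  | sym z =>
    change w = (canonicalModel hL hT).den (canonicalAssignment hL hT) z ↔ _
    rw [den_canonicalModel, ← hT.eq_named_iff w.2 z]
    exact Subtype.ext_iff
  | neg φ ih => exact (not_congr (ih w)).trans w.2.1.neg_mem.symm
  | or φ ψ ih₁ ih₂ => exact (or_congr (ih₁ w) (ih₂ w)).trans w.2.1.or_mem.symm
  | op σ φ ih =>
    constructor
    · rintro ⟨v, hR, hv⟩
      exact hR φ fun i => (ih i (v i)).1 (hv i)
    · intro h
      obtain ⟨A, hA, hφ, hR⟩ := hT.exists_world_successors w.2 σ h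
      exact ⟨fun i => ⟨A i, hA i⟩, hR, fun i => (ih i ⟨A i, hA i⟩).2 (hφ i)⟩
  | sat t z φ ih =>
    change (canonicalModel hL hT).Sat _ φ
      ((canonicalModel hL hT).den (canonicalAssignment hL hT) z) ↔ _
    -- Both sides reduce to `@_z φ ∈ T`, since `w` shares the satisfaction statements of `T`.
    rw [den_canonicalModel, ih, w.2.2]
    exact Iff.rfl

end Canonical

end HybridSignature

theorem mainTheorem2 (L : HybridSignature.{u}) (hL : ∀ t : L.Srt, Nonempty (L.StSym t))
    (Λ : ∀ t : L.Srt, Set (L.Form t)) (s : L.Srt) (Γ : Set (L.Form s))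
    (hΓ : HybridSignature.Consistent Λ Γ) :
    ∃ (M : L.Model) (g : M.Assignment),
      (∃ w : M.W s, ∀ φ ∈ Γ, M.Sat g φ w) ∧
      ∀ (t : L.Srt), ∀ φ ∈ Λ t, ∀ v : M.W t, M.Sat g φ v := by
  obtain ⟨z⟩ := hL s
  obtain ⟨T, hΓT, hT⟩ := hΓ.exists_isMaximalConsistent (.sym z)
  exact ⟨HybridSignature.canonicalModel hL hT, HybridSignature.canonicalAssignment hL hT,
    ⟨⟨T, hT.isWorld_self⟩, fun φ hφ => (HybridSignature.sat_canonicalModel hL hT φ _).2 (hΓT hφ)⟩,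
    fun t φ hφ v => (HybridSignature.sat_canonicalModel hL hT φ v).2 (v.2.1.thm_mem (.ax hφ))⟩
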